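/- Let $N\ge 2$ be an integer, $I_N=\{1,\dots,N-1\}$ and $\Omega_N=\mathbb N^{I_N}$ (with $0\in\mathbb N$), ordered by $\eta\le\xi$ iff $\eta(x)\le\xi(x)$ for all $x\in I_N$. Let $g:\mathbb N\to[0,\infty)$ satisfy $g(0)=0$, $g(k)>0$ for $k\ge1$, and $\sup_{k\ge1}|g(k+1)-g(k)|<\infty$. Let $\kappa>0$, $\theta\ge0$ and $\alpha,\lambda,\beta,\delta\ge0$. The boundary-driven zero-range process on $I_N$ is the continuous-time Markov chain on $\Omega_N$ with generator $\mathcal L^N=\mathcal L^N_0+\kappa(\mathcal L^N_l+\mathcal L^N_r)$, where, for $f:\Omega_N\to\mathbb R$, $$\mathcal L^N_0f(\eta)=\sum_{x,y\in I_N,\ |x-y|=1} g(\eta(x))\,[f(\eta^{x,y})-f(\eta)],$$ $$\mathcal L^N_lf(\eta)=\frac{\alpha}{N^\theta}[f(\eta^{1+})-f(\eta)]+\frac{\lambda g(\eta(1))}{N^\theta}[f(\eta^{1-})-f(\eta)],$$ $$\mathcal L^N_rf(\eta)=\frac{\beta}{N^\theta}[f(\eta^{(N-1)+})-f(\eta)]+\frac{\delta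 g(\eta(N-1))}{N^\theta}[f(\eta^{(N-1)-})-f(\eta)].$$ Here $\eta^{x,y}$ is obtained from $\eta$ by moving one particle from $x$ to $y$, and $\eta^{x\pm}$ by adding, respectively removing, one particle at $x$. For $t\ge0$ let $S(t)$ be the transition kernel of this chain (given by the minimal transition function associated with the jump rates), and for a probability measure $\mu$ on $\Omega_N$ let $\mu S(t)$ be the law at time $t$ of the chain with initial law $\mu$. For probability measures $\mu_1,\mu_2$ on $\Omega_N$ write $\mu_1\le\mu_2$ if $\int f\,d\mu_1\le\int f\,d\mu_2$ for every monotone $f:\Omega_N\to\mathbb R$ (i.e. $f(\eta)\le f(\xi)$ whenever $\eta\le\xi$) that is integrable with respect to both measures. If $g$ is non-decreasing, then the chain is well defined for all times, i.e. $S(t)(\eta,\Omega_N)=1$ for all $\eta\in\Omega_N$ and $t\ge0$, and it is attractive: for all probability measures $\mu_1,\mu_2$ on $\Omega_N$, $$\mu_1\le\mu_2\ \Longrightarrow\ \mu_1S(t)\le\mu_2S(t)\quad\text{for all } t\ge0.$$ -/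

import Mathlib

open MeasureTheory ProbabilityTheory

noncomputable section

/-! ### Stochastic order, and attractiveness of a family of transition kernels -/

/-- Stochastic domination `μ ≤ ν`: `∫ f dμ ≤ ∫ f dν` for all monotone real functions `f` for which
both integrals are defined.  On a discrete space every function is measurable, and by truncation it
is the same to ask for this for bounded monotone `f` only. -/
def StochasticallyLE {Ω : Type*} [Preorder Ω] [MeasurableSpace Ω] (μ ν : Measure Ω) : Prop :=
  ∀ f : Ω → ℝ, Monotone f → Integrable f μ → Integrable f ν → ∫ η, f η ∂μ ≤ ∫ η, f η ∂ν

/-- `S` preserves the stochastic order: `μ ≤ ν` implies `μ S(t) ≤ ν S(t)` for all `t ≥ 0`, where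
`μ S(t)` is the law at time `t` when the initial law is `μ`. -/
def IsAttractive {Ω : Type*} [Preorder Ω] [MeasurableSpace Ω] (S : ℝ → Kernel Ω Ω) : Prop :=
  ∀ μ ν : Measure Ω, IsProbabilityMeasure μ → IsProbabilityMeasure ν →
    StochasticallyLE μ ν → ∀ t : ℝ, 0 ≤ t → StochasticallyLE (μ.bind (S t)) (ν.bind (S t))

/-! ### The continuous-time Markov chain with a given generator on a discrete state space -/

/-- The matrix entry `q(η, ξ)` of a generator: its value at `η` on the indicator of `{ξ}`.
For `ξ ≠ η` it is the rate of jumping from `η` to `ξ`; `-q(η, η)` is the rate of leaving `η`. -/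
def qMatrix {Ω : Type*} (L : (Ω → ℝ) → Ω → ℝ) (η ξ : Ω) : ℝ :=
  L (Set.indicator {ξ} (fun _ => 1)) η

open Classical in
/-- The probability that the chain started at `η` makes fewer than `n` jumps up to time `t` and
is at `ξ` at time `t`: the chain waits at `η` for an exponential time of parameter `-q(η, η)` and
then jumps to `ζ` with probability `q(η, ζ) / (-q(η, η))`. -/
def transitionProbUpTo {Ω : Type*} (L : (Ω → ℝ) → Ω → ℝ) : ℕ → ℝ → Ω → Ω → ENNReal
  | 0, _, _, _ => 0
  | n + 1, t, η, ξ =>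
      (if η = ξ then ENNReal.ofReal (Real.exp (qMatrix L η η * t)) else 0) +
      ∑' ζ : Ω, if ζ = η then 0 else
        ∫⁻ s in Set.Icc (0 : ℝ) t,
          ENNReal.ofReal (Real.exp (qMatrix L η η * s)) * ENNReal.ofReal (qMatrix L η ζ) *
            transitionProbUpTo L n (t - s) ζ ξ

/-- The transition probability `p_t(η, ξ)` of the (minimal) Markov chain with generator `L`. -/
def transitionProb {Ω : Type*} (L : (Ω → ℝ) → Ω → ℝ) (t : ℝ) (η ξ : Ω) : ENNReal :=
  ⨆ n : ℕ, transitionProbUpTo L n t η ξ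

/-- The transition kernels `S(t)` of the Markov chain with generator `L`:
`S(t)(η, A) = ∑_{ξ ∈ A} p_t(η, ξ)` is the probability of being in `A` at time `t` when starting
from `η`, so that `S(t) f (η) = ∫ f d(S(t)(η, ·))`. -/
def markovSemigroup {Ω : Type*} [MeasurableSpace Ω] [DiscreteMeasurableSpace Ω]
    (L : (Ω → ℝ) → Ω → ℝ) (t : ℝ) : Kernel Ω Ω where
  toFun η := Measure.sum fun ξ : Ω => transitionProb L t η ξ • Measure.dirac ξ
  measurable' := measurable_from_top.mono
    (le_of_eq (MeasurableSpace.ext fun s => by simp [MeasurableSet.of_discrete])) le_rfl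

/-! ### The boundary-driven zero-range process -/

/-- The bulk `I_N = {1, …, N - 1}`. -/
abbrev Bulk (N : ℕ) : Type := {x : ℕ // x ∈ Finset.Icc 1 (N - 1)}

/-- The space `Ω_N` of configurations, with its coordinatewise order. -/
abbrev Config (N : ℕ) : Type := Bulk N → ℕ

/-- The site `1`. -/
def leftSite {N : ℕ} (hN : 2 ≤ N) : Bulk N :=
  ⟨1, by rw [Finset.mem_Icc]; omega⟩

/-- The site `N - 1`. -/
def rightSite {N : ℕ} (hN : 2 ≤ N) : Bulk N :=
  ⟨N - 1, by rw [Finset.mem_Icc]; omega⟩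

/-- `η^{x+}`: a particle is created at `x`. -/
def addParticle {N : ℕ} (η : Config N) (x : Bulk N) : Config N :=
  Function.update η x (η x + 1)

/-- `η^{x-}`: a particle is removed from `x`; used only with a rate proportional to `g (η x)`,
which is `0` if there is no particle at `x`. -/
def removeParticle {N : ℕ} (η : Config N) (x : Bulk N) : Config N :=
  Function.update η x (η x - 1)

/-- `η^{x,y}` (for `x ≠ y`): a particle jumps from `x` to `y`; used only with rate `g (η x)`. -/
def moveParticle {N : ℕ} (η : Config N) (x y : Bulk N) : Config N :=
  fun z => if z = x then η z - 1 else if z = y then η z + 1 else η z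

/-- The bulk generator. -/
def bulkGenerator {N : ℕ} (g : ℕ → ℝ) (f : Config N → ℝ) (η : Config N) : ℝ :=
  ∑ x : Bulk N, ∑ y : Bulk N,
    if |((x : ℕ) : ℤ) - ((y : ℕ) : ℤ)| = 1 then g (η x) * (f (moveParticle η x y) - f η) else 0

/-- The generator of the left reservoir. -/
def leftGenerator {N : ℕ} (hN : 2 ≤ N) (g : ℕ → ℝ) (θ α lam : ℝ)
    (f : Config N → ℝ) (η : Config N) : ℝ :=
  α / (N : ℝ) ^ θ * (f (addParticle η (leftSite hN)) - f η) +
    lam * g (η (leftSite hN)) / (N : ℝ) ^ θ * (f (removeParticle η (leftSite hN)) - f η)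

/-- The generator of the right reservoir. -/
def rightGenerator {N : ℕ} (hN : 2 ≤ N) (g : ℕ → ℝ) (θ β δ : ℝ)
    (f : Config N → ℝ) (η : Config N) : ℝ :=
  β / (N : ℝ) ^ θ * (f (addParticle η (rightSite hN)) - f η) +
    δ * g (η (rightSite hN)) / (N : ℝ) ^ θ * (f (removeParticle η (rightSite hN)) - f η)

/-- The generator `L^N = L^N_0 + κ (L^N_l + L^N_r)` of the boundary-driven zero-range process. -/
def zeroRangeGenerator {N : ℕ} (hN : 2 ≤ N) (g : ℕ → ℝ) (κ θ α lam β δ : ℝ)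
    (f : Config N → ℝ) (η : Config N) : ℝ :=
  bulkGenerator g f η +
    κ * (leftGenerator hN g θ α lam f η + rightGenerator hN g θ β δ f η)

end

/-! The generator is a finite sum over events `e` of terms `r e η * (f (T e η) - f η)`, and
everything rests on a minimum principle for the backward equation, with no process or coupled
process ever constructed.

The minimal transition function satisfies the backward integral equation, obtained by conditioning
on the first jump. For `F` with values in [0, 1], the function u(t, η) = S(t)F(η) is therefore
continuous for t ≥ 0 and solves u' = Lu for t > 0 (`hasDerivAt_toReal_semigroupApply`). The minimum
principle `nonneg_of_hasDerivAt_jumpGenerator` says that solutions that are bounded below and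
nonnegative at time 0 stay nonnegative. It needs a function V ≥ 0 with finite sublevel sets and LV
bounded above. Here V is the particle number: bulk jumps conserve it and only the reservoirs create
particles, at constant rate.

Applied to S(t)1 - 1, the principle gives conservativity. Applied to S(t)F(ξ) - S(t)F(η) on the
pairs η ≤ ξ, with the generator of the basic coupling, it shows that S(t) preserves monotone
functions. The coupling never leaves the ordered pairs: a particle jumps alone in ξ only at rate
proportional to g(ξ(x)) - g(η(x)), and this is positive only if η(x) < ξ(x). Attractiveness follows
by integrating the monotone function S(t)F against the initial laws. -/

noncomputable section

/-! ### Jump processes with finitely many kinds of jumps -/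

/-- The generator of the jump process in which `e` happens at rate `r e η` and leads from `η` to
`T e η`. -/
def jumpGenerator {E Ω : Type*} [Fintype E] (r : E → Ω → ℝ) (T : E → Ω → Ω)
    (f : Ω → ℝ) (η : Ω) : ℝ :=
  ∑ e, r e η * (f (T e η) - f η)

open Classical in
/-- The events that change the state `η`. -/
def jumpEvents {E Ω : Type*} [Fintype E] (T : E → Ω → Ω) (η : Ω) : Finset E :=
  Finset.univ.filter fun e => T e η ≠ η

/-- The rate of leaving `η`. -/
def exitRate {E Ω : Type*} [Fintype E] (r : E → Ω → ℝ) (T : E → Ω → Ω) (η : Ω) : ℝ :=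
  ∑ e ∈ jumpEvents T η, r e η

section Jump

variable {E Ω : Type*} [Fintype E] {r : E → Ω → ℝ} {T : E → Ω → Ω}

theorem jumpGenerator_eq_sum_jumpEvents (f : Ω → ℝ) (η : Ω) :
    jumpGenerator r T f η = ∑ e ∈ jumpEvents T η, r e η * (f (T e η) - f η) := by
  classical
  rw [jumpGenerator, jumpEvents, Finset.sum_filter]
  refine Finset.sum_congr rfl fun e _ => ?_
  split_ifs with h
  · rfl
  · rw [not_not] at h
    simp [h]

theorem exitRate_nonneg (hr : ∀ e η, 0 ≤ r e η) (η : Ω) : 0 ≤ exitRate r T η :=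
  Finset.sum_nonneg fun e _ => hr e η

theorem qMatrix_jumpGenerator_self (η : Ω) :
    qMatrix (jumpGenerator r T) η η = -exitRate r T η := by
  classical
  rw [qMatrix, jumpGenerator_eq_sum_jumpEvents, exitRate, ← Finset.sum_neg_distrib]
  refine Finset.sum_congr rfl fun e he => ?_
  have : T e η ≠ η := by simpa [jumpEvents] using he
  simp [Set.indicator, this]

open Classical in
theorem qMatrix_jumpGenerator_of_ne {η ζ : Ω} (h : ζ ≠ η) :
    qMatrix (jumpGenerator r T) η ζ
      = ∑ e ∈ jumpEvents T η, if T e η = ζ then r e η else 0 := by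
  rw [qMatrix, jumpGenerator_eq_sum_jumpEvents]
  refine Finset.sum_congr rfl fun e he => ?_
  simp [Set.indicator, h.symm]

-- The sum over target states becomes a sum over events. Several events may lead to the same state
-- (for `N = 2` the two reservoirs act on the same site), so the matrix entry is split among them;
-- events fixing `η` are invisible to the matrix and drop out. The hypothesis `hm` serves to
-- exchange this finite sum with the integral.
open Classical in
theorem transitionProbUpTo_jumpGenerator_succ (hr : ∀ e η, 0 ≤ r e η) (n : ℕ) (t : ℝ) (η ξ : Ω)
    (hm : ∀ η ξ, Measurable fun t => transitionProbUpTo (jumpGenerator r T) n t η ξ) :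
    transitionProbUpTo (jumpGenerator r T) (n + 1) t η ξ =
      (if η = ξ then ENNReal.ofReal (Real.exp (-exitRate r T η * t)) else 0) +
      ∑ e ∈ jumpEvents T η, ∫⁻ s in Set.Icc (0 : ℝ) t,
          ENNReal.ofReal (Real.exp (-exitRate r T η * s)) * ENNReal.ofReal (r e η) *
            transitionProbUpTo (jumpGenerator r T) n (t - s) (T e η) ξ := by
  rw [transitionProbUpTo, qMatrix_jumpGenerator_self]
  congr 1
  have key : ∀ ζ : Ω, (if ζ = η then 0 else
        ∫⁻ s in Set.Icc (0 : ℝ) t,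
          ENNReal.ofReal (Real.exp (-exitRate r T η * s)) *
            ENNReal.ofReal (qMatrix (jumpGenerator r T) η ζ) *
            transitionProbUpTo (jumpGenerator r T) n (t - s) ζ ξ) =
      ∑ e ∈ jumpEvents T η, if ζ = T e η then ∫⁻ s in Set.Icc (0 : ℝ) t,
          ENNReal.ofReal (Real.exp (-exitRate r T η * s)) * ENNReal.ofReal (r e η) *
            transitionProbUpTo (jumpGenerator r T) n (t - s) (T e η) ξ else 0 := by
    intro ζ
    split_ifs with h
    · symm
      refine Finset.sum_eq_zero fun e he => if_neg ?_
      have : T e η ≠ η := by simpa [jumpEvents] using he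
      rw [h]
      exact this.symm
    · have hmeas : Measurable fun s : ℝ => transitionProbUpTo (jumpGenerator r T) n (t - s) ζ ξ :=
        (hm ζ ξ).comp (measurable_const.sub measurable_id)
      rw [qMatrix_jumpGenerator_of_ne h, ENNReal.ofReal_sum_of_nonneg
        (fun e _ => by split_ifs; exacts [hr e η, le_rfl])]
      simp_rw [Finset.mul_sum, Finset.sum_mul]
      rw [lintegral_finsetSum _ fun e _ => by fun_prop]
      refine Finset.sum_congr rfl fun e _ => ?_
      by_cases h' : ζ = T e η
      · simp [h']
      · simp [h', Ne.symm h']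
  simp_rw [key]
  rw [Summable.tsum_finsetSum fun _ _ => ENNReal.summable]
  exact Finset.sum_congr rfl fun e _ => tsum_ite_eq _ _

theorem measurable_lintegral_Icc_sub {a : ℝ → ENNReal} {b : ℝ → ENNReal} (ha : Measurable a)
    (hb : Measurable b) : Measurable fun t : ℝ => ∫⁻ s in Set.Icc (0 : ℝ) t, a s * b (t - s) := by
  have h : (fun t : ℝ => ∫⁻ s in Set.Icc (0 : ℝ) t, a s * b (t - s)) = fun t => ∫⁻ s,
      Set.indicator {p : ℝ × ℝ | 0 ≤ p.2 ∧ p.2 ≤ p.1} (fun p => a p.2 * b (p.1 - p.2)) (t, s) := by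
    funext t
    rw [← lintegral_indicator measurableSet_Icc]
    rfl
  rw [h]
  refine Measurable.lintegral_prod_right' (f := Set.indicator {p : ℝ × ℝ | 0 ≤ p.2 ∧ p.2 ≤ p.1}
    (fun p => a p.2 * b (p.1 - p.2))) (Measurable.indicator (by fun_prop) ?_)
  exact (measurableSet_le measurable_const measurable_snd).inter
    (measurableSet_le measurable_snd measurable_fst)

theorem measurable_transitionProbUpTo [Countable Ω] (L : (Ω → ℝ) → Ω → ℝ) (n : ℕ) (η ξ : Ω) :
    Measurable fun t => transitionProbUpTo L n t η ξ := by
  classical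
  induction n generalizing η ξ with
  | zero => simp only [transitionProbUpTo]; exact measurable_const
  | succ n ih =>
    simp only [transitionProbUpTo]
    refine Measurable.add ?_ (Measurable.tsum fun ζ => ?_)
    · split_ifs <;> fun_prop
    · split_ifs
      · exact measurable_const
      · exact measurable_lintegral_Icc_sub (by fun_prop) (ih ζ ξ)

theorem measurable_transitionProb [Countable Ω] (L : (Ω → ℝ) → Ω → ℝ) (η ξ : Ω) :
    Measurable fun t => transitionProb L t η ξ :=
  Measurable.iSup fun n => measurable_transitionProbUpTo L n η ξ

theorem monotone_transitionProbUpTo (L : (Ω → ℝ) → Ω → ℝ) (t : ℝ) (η ξ : Ω) :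
    Monotone fun n => transitionProbUpTo L n t η ξ := by
  classical
  refine monotone_nat_of_le_succ fun n => ?_
  induction n generalizing t η ξ with
  | zero => simp only [transitionProbUpTo]; exact zero_le
  | succ n ih =>
    rw [transitionProbUpTo, transitionProbUpTo]
    gcongr with ζ
    split_ifs
    · exact le_rfl
    · exact lintegral_mono fun s => by gcongr; exact ih _ _ _

open Classical in
/-- The backward equation, in integrated form, for the transition probabilities. -/
theorem transitionProb_jumpGenerator_eq [Countable Ω] (hr : ∀ e η, 0 ≤ r e η)
    (t : ℝ) (η ξ : Ω) :
    transitionProb (jumpGenerator r T) t η ξ =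
      (if η = ξ then ENNReal.ofReal (Real.exp (-exitRate r T η * t)) else 0) +
      ∑ e ∈ jumpEvents T η, ∫⁻ s in Set.Icc (0 : ℝ) t,
          ENNReal.ofReal (Real.exp (-exitRate r T η * s)) * ENNReal.ofReal (r e η) *
            transitionProb (jumpGenerator r T) (t - s) (T e η) ξ := by
  have hmeas := fun n (ζ : Ω) => (measurable_transitionProbUpTo (jumpGenerator r T) n ζ ξ).comp
    ((measurable_const (a := t)).sub measurable_id)
  simp only [Function.comp_def, id, Pi.sub_apply] at hmeas
  have hmono := fun s (ζ : Ω) => monotone_transitionProbUpTo (jumpGenerator r T) s ζ ξ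
  rw [transitionProb, ← (hmono t η).iSup_nat_add 1]
  simp_rw [transitionProbUpTo_jumpGenerator_succ hr _ _ _ _
    (measurable_transitionProbUpTo (jumpGenerator r T) _)]
  rw [← ENNReal.add_iSup]
  congr 1
  rw [← ENNReal.finsetSum_iSup_of_monotone]
  · refine Finset.sum_congr rfl fun e _ => ?_
    simp_rw [transitionProb, ENNReal.mul_iSup]
    rw [lintegral_iSup]
    · exact fun n => by have := hmeas n (T e η); fun_prop
    · exact fun m n hmn s => by dsimp only; gcongr; exact hmono _ _ hmn
  · exact fun e m n hmn => lintegral_mono fun s => by gcongr; exact hmono _ _ hmn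

/-- An exponential time of parameter `Q` falls either after `t` or in `[0, t]`. This bounds the
total mass in the induction on the number of jumps. -/
theorem lintegral_Icc_exp_add_le_one {Q t : ℝ} (hQ : 0 ≤ Q) (ht : 0 ≤ t) :
    ENNReal.ofReal (Real.exp (-Q * t)) +
      ∫⁻ s in Set.Icc (0 : ℝ) t, ENNReal.ofReal (Real.exp (-Q * s)) * ENNReal.ofReal Q ≤ 1 := by
  have hint : ∫ s in (0 : ℝ)..t, Real.exp (-Q * s) * Q = 1 - Real.exp (-Q * t) := by
    have h : ∀ s ∈ Set.uIcc 0 t,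
        HasDerivAt (fun s : ℝ => -Real.exp (-Q * s)) (Real.exp (-Q * s) * Q) s := fun s _ => by
      have h2 := (((hasDerivAt_id s).const_mul (-Q)).exp).neg
      simp only [id] at h2
      exact h2.congr_deriv (by ring)
    rw [intervalIntegral.integral_eq_sub_of_hasDerivAt h
      (Continuous.intervalIntegrable (by fun_prop) _ _)]
    simp
    ring
  have hl : ∫⁻ s in Set.Icc (0 : ℝ) t, ENNReal.ofReal (Real.exp (-Q * s)) * ENNReal.ofReal Q =
      ENNReal.ofReal (1 - Real.exp (-Q * t)) := by
    rw [← hint, intervalIntegral.integral_of_le ht, ← integral_Icc_eq_integral_Ioc,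
      ofReal_integral_eq_lintegral_ofReal]
    · exact lintegral_congr fun s => (ENNReal.ofReal_mul (Real.exp_pos _).le).symm
    · exact (Continuous.continuousOn (by fun_prop)).integrableOn_compact isCompact_Icc
    · exact Filter.Eventually.of_forall fun s => mul_nonneg (Real.exp_pos _).le hQ
  rw [hl, ← ENNReal.ofReal_add (Real.exp_pos _).le]
  · simp
  · rw [sub_nonneg, Real.exp_le_one_iff]
    nlinarith

theorem tsum_transitionProbUpTo_le_one [Countable Ω] (hr : ∀ e η, 0 ≤ r e η) (n : ℕ)
    {t : ℝ} (ht : 0 ≤ t) (η : Ω) :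
    ∑' ξ, transitionProbUpTo (jumpGenerator r T) n t η ξ ≤ 1 := by
  classical
  induction n generalizing t η with
  | zero => simp [transitionProbUpTo]
  | succ n ih =>
    have hmeas := fun (ζ ξ : Ω) => (measurable_transitionProbUpTo (jumpGenerator r T) n ζ ξ).comp
      ((measurable_const (a := t)).sub measurable_id)
    simp only [Function.comp_def, id, Pi.sub_apply] at hmeas
    simp_rw [transitionProbUpTo_jumpGenerator_succ hr _ _ _ _
      (measurable_transitionProbUpTo (jumpGenerator r T) _)]
    rw [ENNReal.tsum_add, Summable.tsum_finsetSum fun _ _ => ENNReal.summable]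
    simp_rw [eq_comm (a := η)]
    rw [tsum_ite_eq]
    refine le_trans ?_ (lintegral_Icc_exp_add_le_one (exitRate_nonneg (T := T) hr η) ht)
    gcongr
    rw [exitRate, ENNReal.ofReal_sum_of_nonneg fun e _ => hr e η]
    simp_rw [Finset.mul_sum]
    rw [lintegral_finsetSum _ fun e _ => by fun_prop]
    refine Finset.sum_le_sum fun e _ => ?_
    rw [← lintegral_tsum fun ξ => by have := hmeas (T e η) ξ; fun_prop]
    refine setLIntegral_mono' measurableSet_Icc fun s hs => ?_
    rw [ENNReal.tsum_mul_left]
    exact mul_le_of_le_one_right' (ih (sub_nonneg.2 hs.2) _)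

theorem tsum_transitionProb_le_one [Countable Ω] (hr : ∀ e η, 0 ≤ r e η)
    {t : ℝ} (ht : 0 ≤ t) (η : Ω) :
    ∑' ξ, transitionProb (jumpGenerator r T) t η ξ ≤ 1 := by
  rw [ENNReal.tsum_eq_iSup_sum]
  refine iSup_le fun s => ?_
  simp_rw [transitionProb]
  rw [ENNReal.finsetSum_iSup_of_monotone fun ξ => monotone_transitionProbUpTo _ t η ξ]
  exact iSup_le fun n => (ENNReal.sum_le_tsum s).trans (tsum_transitionProbUpTo_le_one hr n ht η)

/-- The expectation `S(t) F (η)` of `F` at time `t` for the chain started at `η`. -/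
def semigroupApply (L : (Ω → ℝ) → Ω → ℝ) (F : Ω → ℝ) (t : ℝ) (η : Ω) : ENNReal :=
  ∑' ξ, transitionProb L t η ξ * ENNReal.ofReal (F ξ)

theorem measurable_semigroupApply [Countable Ω] (L : (Ω → ℝ) → Ω → ℝ) (F : Ω → ℝ) (η : Ω) :
    Measurable fun t => semigroupApply L F t η :=
  Measurable.tsum fun ξ => (measurable_transitionProb L η ξ).mul_const _

theorem semigroupApply_le_one [Countable Ω] (hr : ∀ e η, 0 ≤ r e η) {F : Ω → ℝ}
    (hF : ∀ η, F η ≤ 1) {t : ℝ} (ht : 0 ≤ t) (η : Ω) :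
    semigroupApply (jumpGenerator r T) F t η ≤ 1 :=
  (ENNReal.tsum_le_tsum fun ξ => mul_le_of_le_one_right'
    (ENNReal.ofReal_le_one.2 (hF ξ))).trans (tsum_transitionProb_le_one hr ht η)

theorem semigroupApply_eq [Countable Ω] (hr : ∀ e η, 0 ≤ r e η) (F : Ω → ℝ) (t : ℝ) (η : Ω) :
    semigroupApply (jumpGenerator r T) F t η =
      ENNReal.ofReal (Real.exp (-exitRate r T η * t)) * ENNReal.ofReal (F η) +
      ∑ e ∈ jumpEvents T η, ∫⁻ s in Set.Icc (0 : ℝ) t,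
          ENNReal.ofReal (Real.exp (-exitRate r T η * s)) * ENNReal.ofReal (r e η) *
            semigroupApply (jumpGenerator r T) F (t - s) (T e η) := by
  classical
  have hmeas := fun (ζ ξ : Ω) => (measurable_transitionProb (jumpGenerator r T) ζ ξ).comp
      ((measurable_const (a := t)).sub measurable_id)
  simp only [Function.comp_def, id, Pi.sub_apply] at hmeas
  rw [semigroupApply]
  conv_lhs => enter [1, ξ]; rw [transitionProb_jumpGenerator_eq hr]
  simp_rw [add_mul, Finset.sum_mul]
  rw [ENNReal.tsum_add, Summable.tsum_finsetSum fun _ _ => ENNReal.summable]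
  congr 1
  · rw [tsum_eq_single η fun ξ hξ => by simp [hξ.symm]]
    simp
  · refine Finset.sum_congr rfl fun e _ => ?_
    simp_rw [semigroupApply, ← ENNReal.tsum_mul_left]
    rw [lintegral_tsum fun ξ => by have := hmeas (T e η) ξ; fun_prop]
    refine tsum_congr fun ξ => ?_
    rw [← lintegral_mul_const _ (by have := hmeas (T e η) ξ; fun_prop)]
    simp_rw [mul_assoc]

end Jump

/-! ### The backward equation for real-valued expectations. -/

section Real

variable {E Ω : Type*} [Fintype E] {r : E → Ω → ℝ} {T : E → Ω → Ω}

theorem intervalIntegrable_mul_semigroupApply [Countable Ω] (hr : ∀ e η, 0 ≤ r e η) {F : Ω → ℝ}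
    (hF : ∀ η, F η ≤ 1) (Q : ℝ) (η : Ω) {t : ℝ} (ht : 0 ≤ t) :
    IntervalIntegrable
      (fun s => Real.exp (Q * s) * (semigroupApply (jumpGenerator r T) F s η).toReal)
      volume 0 t := by
  rw [intervalIntegrable_iff_integrableOn_Icc_of_le ht]
  refine Integrable.mul_bdd (c := 1) ((Continuous.continuousOn (by fun_prop)).integrableOn_compact
    isCompact_Icc) (measurable_semigroupApply _ F η).ennreal_toReal.aestronglyMeasurable ?_
  refine (ae_restrict_mem measurableSet_Icc).mono fun s hs => ?_
  rw [Real.norm_of_nonneg ENNReal.toReal_nonneg]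
  exact ENNReal.toReal_le_of_le_ofReal zero_le_one
    (by simpa using semigroupApply_le_one hr hF hs.1 η)

/-- The variation of constants form of the backward equation. -/
theorem toReal_semigroupApply_eq [Countable Ω] (hr : ∀ e η, 0 ≤ r e η) {F : Ω → ℝ}
    (hF0 : ∀ η, 0 ≤ F η) (hF : ∀ η, F η ≤ 1) {t : ℝ} (ht : 0 ≤ t) (η : Ω) :
    (semigroupApply (jumpGenerator r T) F t η).toReal =
      Real.exp (-exitRate r T η * t) * (F η + ∑ e ∈ jumpEvents T η, r e η *
        ∫ s in (0 : ℝ)..t, Real.exp (exitRate r T η * s) *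
          (semigroupApply (jumpGenerator r T) F s (T e η)).toReal) := by
  set Q := exitRate r T η with hQ
  have hfin : semigroupApply (jumpGenerator r T) F t η ≠ ⊤ :=
    ne_top_of_le_ne_top ENNReal.one_ne_top (semigroupApply_le_one hr hF ht η)
  have heq := semigroupApply_eq (T := T) hr F t η
  rw [← hQ] at heq
  rw [heq] at hfin
  rw [heq, ENNReal.toReal_add (ENNReal.add_ne_top.1 hfin).1 (ENNReal.add_ne_top.1 hfin).2,
    ENNReal.toReal_sum fun e he => ENNReal.sum_ne_top.1 (ENNReal.add_ne_top.1 hfin).2 e he,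
    mul_add, Finset.mul_sum, ENNReal.toReal_mul, ENNReal.toReal_ofReal (Real.exp_pos _).le,
    ENNReal.toReal_ofReal (hF0 η)]
  congr 1
  refine Finset.sum_congr rfl fun e _ => ?_
  have h1 : ∫⁻ s in Set.Icc (0 : ℝ) t, ENNReal.ofReal (Real.exp (-Q * s)) *
      ENNReal.ofReal (r e η) * semigroupApply (jumpGenerator r T) F (t - s) (T e η) =
      ∫⁻ s in Set.Icc (0 : ℝ) t, ENNReal.ofReal (Real.exp (-Q * s) * r e η *
        (semigroupApply (jumpGenerator r T) F (t - s) (T e η)).toReal) := by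
    refine setLIntegral_congr_fun measurableSet_Icc fun s hs => ?_
    rw [ENNReal.ofReal_mul (mul_nonneg (Real.exp_pos _).le (hr e η)),
      ENNReal.ofReal_mul (Real.exp_pos _).le, ENNReal.ofReal_toReal]
    exact ne_top_of_le_ne_top ENNReal.one_ne_top
      (semigroupApply_le_one hr hF (sub_nonneg.2 hs.2) _)
  have hmeas : Measurable fun s =>
      (semigroupApply (jumpGenerator r T) F (t - s) (T e η)).toReal :=
    ((measurable_semigroupApply _ F (T e η)).comp
      ((measurable_const (a := t)).sub measurable_id)).ennreal_toReal
  rw [h1, ← integral_eq_lintegral_of_nonneg_ae, integral_Icc_eq_integral_Ioc,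
    ← intervalIntegral.integral_of_le ht]
  -- Substituting `t - s` for `s` pulls `exp (-Q * t)` out and leaves an integrand free of `t`, so
  -- that the result can be differentiated in `t`.
  · have h2 := intervalIntegral.integral_comp_sub_left (a := 0) (b := t) (fun s =>
      Real.exp (-Q * (t - s)) * r e η *
        (semigroupApply (jumpGenerator r T) F s (T e η)).toReal) t
    simp only [sub_sub_cancel, sub_self, sub_zero] at h2
    rw [h2, ← intervalIntegral.integral_const_mul, ← intervalIntegral.integral_const_mul]
    refine intervalIntegral.integral_congr fun s _ => ?_
    have h3 : Real.exp (-Q * (t - s)) = Real.exp (-Q * t) * Real.exp (Q * s) := by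
      rw [← Real.exp_add]
      ring_nf
    rw [h3]
    ring
  · exact Filter.Eventually.of_forall fun s =>
      mul_nonneg (mul_nonneg (Real.exp_pos _).le (hr e η)) ENNReal.toReal_nonneg
  · exact (Measurable.mul (by fun_prop) hmeas).aestronglyMeasurable

/-- A primitive of an integrable function is continuous, so the integral equation improves
boundedness and measurability to continuity. Fed back into the equation, continuity yields
differentiability. -/
theorem continuousOn_toReal_semigroupApply [Countable Ω] (hr : ∀ e η, 0 ≤ r e η) {F : Ω → ℝ}
    (hF0 : ∀ η, 0 ≤ F η) (hF : ∀ η, F η ≤ 1) (η : Ω) (b : ℝ) :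
    ContinuousOn (fun t => (semigroupApply (jumpGenerator r T) F t η).toReal) (Set.Icc 0 b) := by
  rcases lt_or_ge b 0 with hb | hb
  · simp [Set.Icc_eq_empty_of_lt hb]
  refine ContinuousOn.congr ?_ fun t ht => toReal_semigroupApply_eq (T := T) hr hF0 hF ht.1 η
  refine ContinuousOn.mul (by fun_prop) (continuousOn_const.add
    (continuousOn_finsetSum _ fun e _ => continuousOn_const.mul ?_))
  have hint := (intervalIntegrable_iff_integrableOn_Icc_of_le hb).1
    (intervalIntegrable_mul_semigroupApply (T := T) hr hF (exitRate r T η) (T e η) hb)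
  rw [← Set.uIcc_of_le hb] at hint
  have h := intervalIntegral.continuousOn_primitive_interval hint
  rwa [Set.uIcc_of_le hb] at h

/-- The backward equation. -/
theorem hasDerivAt_toReal_semigroupApply [Countable Ω] (hr : ∀ e η, 0 ≤ r e η) {F : Ω → ℝ}
    (hF0 : ∀ η, 0 ≤ F η) (hF : ∀ η, F η ≤ 1) (η : Ω) {t : ℝ} (ht : 0 < t) :
    HasDerivAt (fun t => (semigroupApply (jumpGenerator r T) F t η).toReal)
      (jumpGenerator r T (fun ζ => (semigroupApply (jumpGenerator r T) F t ζ).toReal) η) t := by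
  have hcont : ∀ ζ, ContinuousAt
      (fun t => (semigroupApply (jumpGenerator r T) F t ζ).toReal) t := fun ζ =>
    (continuousOn_toReal_semigroupApply (T := T) hr hF0 hF ζ (t + 1)).continuousAt
      (Icc_mem_nhds ht (by linarith))
  set Q := exitRate r T η with hQ
  have hint : ∀ e, HasDerivAt (fun t => ∫ s in (0 : ℝ)..t, Real.exp (Q * s) *
      (semigroupApply (jumpGenerator r T) F s (T e η)).toReal)
      (Real.exp (Q * t) * (semigroupApply (jumpGenerator r T) F t (T e η)).toReal) t := fun e =>
    intervalIntegral.integral_hasDerivAt_right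
      (intervalIntegrable_mul_semigroupApply hr hF Q (T e η) ht.le)
      (Measurable.stronglyMeasurable (Measurable.mul (by fun_prop)
        (measurable_semigroupApply _ F (T e η)).ennreal_toReal)).stronglyMeasurableAtFilter
      (ContinuousAt.mul (by fun_prop) (hcont _))
  have hexp : HasDerivAt (fun t : ℝ => Real.exp (-Q * t)) (-Q * Real.exp (-Q * t)) t := by
    have h2 := ((hasDerivAt_id t).const_mul (-Q)).exp
    simp only [id] at h2
    exact h2.congr_deriv (by ring)
  have hsum := hexp.fun_mul ((HasDerivAt.fun_sum (u := jumpEvents T η)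
    fun e _ => (hint e).const_mul (r e η)).const_add (F η))
  have heq := toReal_semigroupApply_eq (T := T) hr hF0 hF ht.le η
  rw [← hQ] at heq
  refine (hsum.congr_of_eventuallyEq ?_).congr_deriv ?_
  · filter_upwards [lt_mem_nhds ht] with s hs
    exact toReal_semigroupApply_eq (T := T) hr hF0 hF hs.le η
  · rw [mul_assoc, ← heq, jumpGenerator_eq_sum_jumpEvents, Finset.mul_sum]
    simp_rw [mul_sub]
    rw [Finset.sum_sub_distrib, ← Finset.sum_mul, ← exitRate, ← hQ]
    have h3 : Real.exp (-Q * t) * Real.exp (Q * t) = 1 := by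
      rw [← Real.exp_add]
      simp
    have h4 : ∀ e, Real.exp (-Q * t) * (r e η * (Real.exp (Q * t) *
        (semigroupApply (jumpGenerator r T) F t (T e η)).toReal)) =
        r e η * (semigroupApply (jumpGenerator r T) F t (T e η)).toReal := fun e => by
      linear_combination
        r e η * (semigroupApply (jumpGenerator r T) F t (T e η)).toReal * h3
    simp_rw [h4]
    ring

end Real

/-! ### The minimum principle -/

/-- A function on `[0, b]` that is bounded below, nonnegative at time `0`, and solves the backward
equation on a set that the jumps do not leave, stays nonnegative, provided that there is a function
`V` with finite sublevel sets whose growth rate is bounded. -/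
theorem nonneg_of_hasDerivAt_jumpGenerator {E X : Type*} [Fintype E] {r : E → X → ℝ}
    {T : E → X → X} {A : Set X}
    (hr : ∀ e, ∀ x ∈ A, 0 ≤ r e x)
    (hA : ∀ e, ∀ x ∈ A, 0 < r e x → T e x ∈ A)
    {V : X → ℝ} (hV0 : ∀ x, 0 ≤ V x) (hVfin : ∀ M : ℝ, {x | V x ≤ M}.Finite)
    {C : ℝ} (hVC : ∀ x ∈ A, jumpGenerator r T V x ≤ C)
    {w : ℝ → X → ℝ} {b B : ℝ} (hwB : ∀ t ∈ Set.Icc 0 b, ∀ x ∈ A, -B ≤ w t x)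
    (hw0 : ∀ x ∈ A, 0 ≤ w 0 x)
    (hcont : ∀ x ∈ A, ContinuousOn (fun t => w t x) (Set.Icc 0 b))
    (hderiv : ∀ x ∈ A, ∀ t ∈ Set.Ioc 0 b,
      HasDerivAt (fun t => w t x) (jumpGenerator r T (w t) x) t) :
    ∀ t ∈ Set.Icc 0 b, ∀ x ∈ A, 0 ≤ w t x := by
  set D := |C| + 1 with hD
  have hDpos : 0 < D := by positivity
  -- The term `ε * V` confines negative values to a finite set, so a negative minimum is attained;
  -- the term `ε * D * t`, with `D > C`, forces a strictly positive time derivative there.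
  have main : ∀ ε > 0, ∀ t ∈ Set.Icc 0 b, ∀ x ∈ A, 0 ≤ w t x + ε * (V x + D * t) := by
    intro ε hε
    by_contra! hneg
    obtain ⟨t₁, ht₁, x₁, hx₁, hneg⟩ := hneg
    set W : ℝ → X → ℝ := fun t x => w t x + ε * (V x + D * t) with hW
    set S : Set X := {x | x ∈ A ∧ V x ≤ B / ε} with hS
    have hlarge : ∀ t ∈ Set.Icc 0 b, ∀ x ∈ A, x ∉ S → 0 ≤ W t x := by
      intro t ht x hx hxS
      have h1 : B / ε < V x := by
        by_contra! h
        exact hxS ⟨hx, h⟩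
      rw [div_lt_iff₀ hε] at h1
      have h2 := hwB t ht x hx
      have h3 : 0 ≤ ε * (D * t) := mul_nonneg hε.le (mul_nonneg hDpos.le ht.1)
      simp only [hW]
      nlinarith
    have hSfin : S.Finite := (hVfin (B / ε)).subset fun x hx => hx.2
    have hWcont : ∀ x ∈ A, ContinuousOn (fun t => W t x) (Set.Icc 0 b) := fun x hx =>
      (hcont x hx).add (by fun_prop)
    have hbne : (Set.Icc 0 b).Nonempty := ⟨t₁, ht₁⟩
    have hx₁S : x₁ ∈ S := by
      by_contra h
      exact absurd (hlarge t₁ ht₁ x₁ hx₁ h) (not_le.2 hneg)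
    have hmin : ∀ x, ∃ s ∈ Set.Icc 0 b, x ∈ A → ∀ t ∈ Set.Icc 0 b, W s x ≤ W t x := by
      intro x
      by_cases hx : x ∈ A
      · obtain ⟨s, hs, hs'⟩ := isCompact_Icc.exists_isMinOn hbne (hWcont x hx)
        exact ⟨s, hs, fun _ t ht => hs' ht⟩
      · exact ⟨t₁, ht₁, fun h => absurd h hx⟩
    choose s hs hsmin using hmin
    obtain ⟨x₀, hx₀, hx₀min⟩ :=
      Set.exists_min_image S (fun x => W (s x) x) hSfin ⟨x₁, hx₁S⟩
    set t₀ := s x₀ with ht₀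
    have ht₀mem : t₀ ∈ Set.Icc 0 b := hs x₀
    have hneg₀ : W t₀ x₀ < 0 :=
      ((hx₀min x₁ hx₁S).trans (hsmin x₁ hx₁ t₁ ht₁)).trans_lt hneg
    have hglob : ∀ t ∈ Set.Icc 0 b, ∀ x ∈ A, W t₀ x₀ ≤ W t x := by
      intro t ht x hx
      by_cases hxS : x ∈ S
      · exact (hx₀min x hxS).trans (hsmin x hx t ht)
      · exact hneg₀.le.trans (hlarge t ht x hx hxS)
    have ht₀pos : 0 < t₀ := by
      rcases ht₀mem.1.eq_or_lt with h | h
      · exfalso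
        have h1 := hw0 x₀ hx₀.1
        have h2 := mul_nonneg hε.le (hV0 x₀)
        simp only [hW, ← h] at hneg₀
        linarith
      · exact h
    have hd : HasDerivAt (fun t => W t x₀) (jumpGenerator r T (w t₀) x₀ + ε * (D * 1)) t₀ :=
      (hderiv x₀ hx₀.1 t₀ ⟨ht₀pos, ht₀mem.2⟩).add
        ((((hasDerivAt_id t₀).const_mul D).const_add (V x₀)).const_mul ε)
    -- At a global minimum over `A` the generator is nonnegative, since jumps of positive rate stay
    -- in `A`. Passing from `W` to `w` costs at most `ε * C`, which is less than `ε * D`.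
    have hpos : 0 < jumpGenerator r T (w t₀) x₀ + ε * (D * 1) := by
      have h1 : 0 ≤ jumpGenerator r T (W t₀) x₀ := by
        refine Finset.sum_nonneg fun e _ => ?_
        rcases (hr e x₀ hx₀.1).eq_or_lt with h | h
        · simp [← h]
        · exact mul_nonneg h.le (sub_nonneg.2 (hglob t₀ ht₀mem _ (hA e x₀ hx₀.1 h)))
      have h2 : jumpGenerator r T (W t₀) x₀ =
          jumpGenerator r T (w t₀) x₀ + ε * jumpGenerator r T V x₀ := by
        simp only [jumpGenerator, hW, Finset.mul_sum, ← Finset.sum_add_distrib]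
        exact Finset.sum_congr rfl fun e _ => by ring
      have h3 : jumpGenerator r T V x₀ < D * 1 :=
        (hVC x₀ hx₀.1).trans_lt (by rw [hD, mul_one]; linarith [le_abs_self C])
      have h4 := mul_lt_mul_of_pos_left h3 hε
      linarith
    -- A positive derivative makes `W` smaller just before `t₀`, against minimality. Looking only to
    -- the left also covers `t₀ = b`.
    have hlt : ∀ᶠ t in nhdsWithin t₀ (Set.Iio t₀), W t x₀ < W t₀ x₀ := by
      have hslope := (hasDerivWithinAt_iff_tendsto_slope' (by simp)).1
        (hd.hasDerivWithinAt (s := Set.Iio t₀))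
      filter_upwards [hslope.eventually (lt_mem_nhds hpos), self_mem_nhdsWithin] with t ht htlt
      rw [slope_def_field, div_pos_iff] at ht
      rcases ht with h | h
      · exact absurd h.2 (by simpa using (Set.mem_Iio.1 htlt).le)
      · exact sub_neg.1 h.1
    have hge : ∀ᶠ t in nhdsWithin t₀ (Set.Iio t₀), W t₀ x₀ ≤ W t x₀ := by
      filter_upwards [self_mem_nhdsWithin, nhdsWithin_le_nhds (lt_mem_nhds ht₀pos)] with t h1 h2
      exact hglob t ⟨h2.le, (Set.mem_Iio.1 h1).le.trans ht₀mem.2⟩ x₀ hx₀.1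
    obtain ⟨t, h1, h2⟩ := (hlt.and hge).exists
    exact absurd h1 (not_lt.2 h2)
  intro t ht x hx
  by_contra! hneg
  have hV : 0 ≤ V x + D * t := add_nonneg (hV0 x) (mul_nonneg hDpos.le ht.1)
  -- This `ε` makes the perturbation at most `-w t x / 2`, too small to compensate a negative `w t
  -- x`.
  have h := main (-w t x / (2 * (V x + D * t + 1))) (by apply div_pos <;> linarith) t ht x hx
  rw [div_mul_eq_mul_div] at h
  have h2 : -w t x * (V x + D * t) / (2 * (V x + D * t + 1)) ≤ -w t x / 2 := by
    rw [div_le_div_iff₀ (by linarith) two_pos]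
    nlinarith
  linarith


/-! ### Conservativity and monotonicity of the semigroup of a jump process -/

section Semigroup

variable {E Ω : Type*} [Fintype E] [Countable Ω] {r : E → Ω → ℝ} {T : E → Ω → Ω}

theorem toReal_semigroupApply_zero (hr : ∀ e η, 0 ≤ r e η) {F : Ω → ℝ}
    (hF0 : ∀ η, 0 ≤ F η) (hF : ∀ η, F η ≤ 1) (η : Ω) :
    (semigroupApply (jumpGenerator r T) F 0 η).toReal = F η := by
  simp [toReal_semigroupApply_eq (T := T) hr hF0 hF le_rfl]

theorem toReal_semigroupApply_le_one (hr : ∀ e η, 0 ≤ r e η) {F : Ω → ℝ}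
    (hF : ∀ η, F η ≤ 1) {t : ℝ} (ht : 0 ≤ t) (η : Ω) :
    (semigroupApply (jumpGenerator r T) F t η).toReal ≤ 1 :=
  ENNReal.toReal_le_of_le_ofReal zero_le_one (by simpa using semigroupApply_le_one hr hF ht η)

theorem tsum_transitionProb_eq_one (hr : ∀ e η, 0 ≤ r e η) {V : Ω → ℝ} (hV0 : ∀ x, 0 ≤ V x)
    (hVfin : ∀ M : ℝ, {x | V x ≤ M}.Finite) {C : ℝ} (hVC : ∀ x, jumpGenerator r T V x ≤ C)
    {t : ℝ} (ht : 0 ≤ t) (η : Ω) :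
    ∑' ξ, transitionProb (jumpGenerator r T) t η ξ = 1 := by
  refine le_antisymm (tsum_transitionProb_le_one hr ht η) ?_
  have h0 : ∀ ζ : Ω, (0 : ℝ) ≤ (fun _ : Ω => (1 : ℝ)) ζ := fun _ => zero_le_one
  have h1 : ∀ ζ : Ω, (fun _ : Ω => (1 : ℝ)) ζ ≤ 1 := fun _ => le_rfl
  have h := nonneg_of_hasDerivAt_jumpGenerator (r := r) (T := T) (A := Set.univ) (V := V) (C := C)
    (w := fun t ζ => (semigroupApply (jumpGenerator r T) (fun _ => 1) t ζ).toReal - 1)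
    (b := t) (B := 1) (fun e x _ => hr e x) (fun _ _ _ _ => trivial) hV0 hVfin (fun x _ => hVC x)
    (fun s _ x _ => by
      have : 0 ≤ (semigroupApply (jumpGenerator r T) (fun _ => 1) s x).toReal :=
        ENNReal.toReal_nonneg
      linarith)
    (fun x _ => by simp [toReal_semigroupApply_zero (T := T) hr h0 h1])
    (fun x _ => (continuousOn_toReal_semigroupApply hr h0 h1 x t).sub continuousOn_const)
    (fun x _ s hs => ((hasDerivAt_toReal_semigroupApply (T := T) hr h0 h1 x hs.1).sub_const
      1).congr_deriv (by simp [jumpGenerator]))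
    t ⟨ht, le_rfl⟩ η trivial
  have h2 : semigroupApply (jumpGenerator r T) (fun _ => 1) t η =
      ∑' ξ, transitionProb (jumpGenerator r T) t η ξ := by simp [semigroupApply]
  rw [sub_nonneg, h2] at h
  have h3 := ENNReal.ofReal_le_ofReal h
  rwa [ENNReal.ofReal_one, ENNReal.ofReal_toReal (ne_top_of_le_ne_top ENNReal.one_ne_top
    (tsum_transitionProb_le_one hr ht η))] at h3

/-- Rates of the basic coupling of two copies of a jump process with monotone rates: `Sum.inl e`
is the event `e` in both copies, `Sum.inr e` is the event `e` in the second copy only. -/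
def coupledRate (r : E → Ω → ℝ) : E ⊕ E → Ω × Ω → ℝ
  | Sum.inl e, p => r e p.1
  | Sum.inr e, p => r e p.2 - r e p.1

/-- The jumps of the basic coupling. -/
def coupledJump (T : E → Ω → Ω) : E ⊕ E → Ω × Ω → Ω × Ω
  | Sum.inl e, p => (T e p.1, T e p.2)
  | Sum.inr e, p => (p.1, T e p.2)

omit [Countable Ω] in
-- Each marginal of the coupling is the original dynamics, as the two rates of `e` add up to `r e
-- p.2`. It is used both for the difference of two expectations and for the Lyapunov function `V p.2
-- + V p.1`.
theorem jumpGenerator_coupled (u v : Ω → ℝ) (p : Ω × Ω) :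
    jumpGenerator (coupledRate r) (coupledJump T) (fun q => v q.2 + u q.1) p =
      jumpGenerator r T v p.2 + jumpGenerator r T u p.1 := by
  simp only [jumpGenerator, Fintype.sum_sum_type, coupledRate, coupledJump,
    ← Finset.sum_add_distrib]
  exact Finset.sum_congr rfl fun e _ => by ring

/-- Minimum principle for the basic coupling on ordered pairs: `hrmono` makes the coupled rates
nonnegative there, `hT` preserves order under joint jumps, and `hTr` under jumps of the larger copy
alone. -/
theorem monotone_toReal_semigroupApply [Preorder Ω] (hr : ∀ e η, 0 ≤ r e η)
    (hrmono : ∀ e, Monotone (r e)) (hT : ∀ e, Monotone (T e))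
    (hTr : ∀ e η ξ, η ≤ ξ → r e η < r e ξ → η ≤ T e ξ)
    {V : Ω → ℝ} (hV0 : ∀ x, 0 ≤ V x)
    (hVfin : ∀ M : ℝ, {x | V x ≤ M}.Finite) {C : ℝ} (hVC : ∀ x, jumpGenerator r T V x ≤ C)
    {F : Ω → ℝ} (hFmono : Monotone F) (hF0 : ∀ η, 0 ≤ F η) (hF : ∀ η, F η ≤ 1)
    {t : ℝ} (ht : 0 ≤ t) :
    Monotone fun η => (semigroupApply (jumpGenerator r T) F t η).toReal := by
  intro η ξ hηξ
  have h := nonneg_of_hasDerivAt_jumpGenerator (r := coupledRate r) (T := coupledJump T)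
    (A := {p : Ω × Ω | p.1 ≤ p.2}) (V := fun p => V p.2 + V p.1) (C := C + C)
    (w := fun t p => (semigroupApply (jumpGenerator r T) F t p.2).toReal +
      -(semigroupApply (jumpGenerator r T) F t p.1).toReal)
    (b := t) (B := 1) ?_ ?_ (fun p => add_nonneg (hV0 _) (hV0 _)) ?_
    (fun p _ => by
      rw [jumpGenerator_coupled V V]
      exact add_le_add (hVC _) (hVC _))
    (fun s hs p _ => by
      have h1 : 0 ≤ (semigroupApply (jumpGenerator r T) F s p.2).toReal := ENNReal.toReal_nonneg
      have h2 := toReal_semigroupApply_le_one (T := T) hr hF hs.1 p.1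
      linarith)
    (fun p hp => by
      simp only [toReal_semigroupApply_zero (T := T) hr hF0 hF]
      have := hFmono hp
      linarith)
    (fun p _ => (continuousOn_toReal_semigroupApply hr hF0 hF p.2 t).add
      (continuousOn_toReal_semigroupApply hr hF0 hF p.1 t).neg)
    (fun p _ s hs => ((hasDerivAt_toReal_semigroupApply (T := T) hr hF0 hF p.2 hs.1).add
      (hasDerivAt_toReal_semigroupApply (T := T) hr hF0 hF p.1 hs.1).neg).congr_deriv ?_)
    t ⟨ht, le_rfl⟩ (η, ξ) hηξ
  · dsimp only at h ⊢
    linarith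
  · rintro (e | e) p hp
    · exact hr e _
    · exact sub_nonneg.2 (hrmono e hp)
  · rintro (e | e) p hp hpos
    · exact hT e hp
    · exact hTr e _ _ hp (sub_pos.1 hpos)
  · intro M
    refine ((hVfin M).prod (hVfin M)).subset fun p hp => ?_
    have h1 := hV0 p.1
    have h2 := hV0 p.2
    simp only [Set.mem_ofPred_eq, Set.mem_prod] at hp ⊢
    constructor <;> linarith
  · rw [jumpGenerator_coupled
      (fun ζ => -(semigroupApply (jumpGenerator r T) F s ζ).toReal)
      (fun ζ => (semigroupApply (jumpGenerator r T) F s ζ).toReal)]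
    congr 1
    simp only [jumpGenerator, ← Finset.sum_neg_distrib]
    exact Finset.sum_congr rfl fun e _ => by ring

end Semigroup

/-! ### Stochastic domination -/

/-- Truncating `f` to `[-c n, c n]` keeps it monotone, an affine map brings it into `[0, 1]`, and
dominated convergence removes the truncation. -/
theorem stochasticallyLE_of_bounded {Ω : Type*} [Preorder Ω] [MeasurableSpace Ω]
    {μ ν : Measure Ω} [IsProbabilityMeasure μ] [IsProbabilityMeasure ν]
    (h : ∀ F : Ω → ℝ, Monotone F → (∀ η, 0 ≤ F η) → (∀ η, F η ≤ 1) →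
      ∫ η, F η ∂μ ≤ ∫ η, F η ∂ν) : StochasticallyLE μ ν := by
  intro f hf hμ hν
  set c : ℕ → ℝ := fun n => (n : ℝ) + 1 with hc
  have hcpos : ∀ n, 0 < c n := fun n => by positivity
  set τ : ℕ → Ω → ℝ := fun n η => max (-c n) (min (f η) (c n)) with hτ
  have hτabs : ∀ n η, |τ n η| ≤ |f η| := fun n η => by
    have := hcpos n
    simp only [hτ]
    rcases abs_cases (f η) with h1 | h1 <;>
    rcases min_cases (f η) (c n) with h2 | h2 <;>
    rcases max_cases (-c n) (min (f η) (c n)) with h3 | h3 <;>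
    rw [abs_le] <;> constructor <;> linarith
  have hτint : ∀ (ρ : Measure Ω) [IsProbabilityMeasure ρ], Integrable f ρ →
      ∀ n, Integrable (τ n) ρ := fun ρ _ hρ n =>
    hρ.mono (aestronglyMeasurable_const.sup (hρ.aestronglyMeasurable.inf
      aestronglyMeasurable_const)) (Filter.Eventually.of_forall fun η => hτabs n η)
  have hlim : ∀ (ρ : Measure Ω) [IsProbabilityMeasure ρ], Integrable f ρ →
      Filter.Tendsto (fun n => ∫ η, τ n η ∂ρ) Filter.atTop (nhds (∫ η, f η ∂ρ)) := by
    intro ρ _ hρ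
    refine tendsto_integral_of_dominated_convergence (fun η => |f η|)
      (fun n => (hτint ρ hρ n).aestronglyMeasurable) hρ.abs
      (fun n => Filter.Eventually.of_forall fun η => hτabs n η)
      (Filter.Eventually.of_forall fun η => ?_)
    refine tendsto_const_nhds.congr' ?_
    obtain ⟨m, hm⟩ := exists_nat_ge |f η|
    filter_upwards [Filter.eventually_ge_atTop m] with n hn
    have h1 : |f η| ≤ c n := by
      have : (m : ℝ) ≤ n := Nat.cast_le.2 hn
      simp only [hc]
      linarith
    simp only [hτ]
    rw [min_eq_left (abs_le.1 h1).2, max_eq_right (abs_le.1 h1).1]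
  refine le_of_tendsto_of_tendsto' (hlim μ hμ) (hlim ν hν) fun n => ?_
  have hbd := h (fun η => (τ n η + c n) / (2 * c n))
    (fun η ξ hηξ => by
      have := hcpos n
      have := hf hηξ
      dsimp only
      gcongr
      exact max_le_max le_rfl (min_le_min this le_rfl))
    (fun η => div_nonneg (by linarith [le_max_left (-c n) (min (f η) (c n))])
      (by linarith [hcpos n]))
    (fun η => by
      have := hcpos n
      rw [div_le_one (by linarith)]
      have : τ n η ≤ c n := max_le (by linarith) (min_le_right _ _)
      linarith)
  rw [integral_div, integral_div, integral_add (hτint μ hμ n) (integrable_const _),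
    integral_add (hτint ν hν n) (integrable_const _),
    div_le_div_iff_of_pos_right (by linarith [hcpos n])] at hbd
  simpa using hbd

/-! ### From the action on functions to the action on measures. -/

section Kernel

variable {Ω : Type*} [Countable Ω] [MeasurableSpace Ω] [DiscreteMeasurableSpace Ω]

omit [Countable Ω] in
theorem markovSemigroup_apply_univ (L : (Ω → ℝ) → Ω → ℝ) (t : ℝ) (η : Ω) :
    markovSemigroup L t η Set.univ = ∑' ξ, transitionProb L t η ξ := by
  change (Measure.sum fun ξ : Ω => transitionProb L t η ξ • Measure.dirac ξ) Set.univ = _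
  simp [Measure.sum_apply]

omit [Countable Ω] in
theorem lintegral_markovSemigroup (L : (Ω → ℝ) → Ω → ℝ) (t : ℝ) (η : Ω) (F : Ω → ℝ) :
    ∫⁻ ξ, ENNReal.ofReal (F ξ) ∂markovSemigroup L t η = semigroupApply L F t η := by
  change ∫⁻ ξ, ENNReal.ofReal (F ξ)
    ∂(Measure.sum fun ξ : Ω => transitionProb L t η ξ • Measure.dirac ξ) = _
  simp [semigroupApply, lintegral_sum_measure]

theorem integral_bind_markovSemigroup {E : Type*} [Fintype E] {r : E → Ω → ℝ} {T : E → Ω → Ω}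
    (hr : ∀ e η, 0 ≤ r e η) {F : Ω → ℝ} (hF0 : ∀ η, 0 ≤ F η) (hF : ∀ η, F η ≤ 1)
    {t : ℝ} (ht : 0 ≤ t) (μ : Measure Ω) :
    ∫ η, F η ∂(μ.bind (markovSemigroup (jumpGenerator r T) t)) =
      ∫ η, (semigroupApply (jumpGenerator r T) F t η).toReal ∂μ := by
  rw [integral_eq_lintegral_of_nonneg_ae (Filter.Eventually.of_forall hF0)
      (Measurable.of_discrete).aestronglyMeasurable,
    Measure.lintegral_bind (Kernel.aemeasurable _) (Measurable.of_discrete).aemeasurable,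
    integral_toReal (Measurable.of_discrete).aemeasurable (Filter.Eventually.of_forall fun η =>
      (semigroupApply_le_one hr hF ht η).trans_lt ENNReal.one_lt_top)]
  simp_rw [lintegral_markovSemigroup]

theorem isMarkovKernel_and_isAttractive_of_jumpGenerator {E : Type*} [Fintype E] [Preorder Ω]
    {r : E → Ω → ℝ} {T : E → Ω → Ω} (hr : ∀ e η, 0 ≤ r e η)
    (hrmono : ∀ e, Monotone (r e)) (hT : ∀ e, Monotone (T e))
    (hTr : ∀ e η ξ, η ≤ ξ → r e η < r e ξ → η ≤ T e ξ)
    {V : Ω → ℝ} (hV0 : ∀ x, 0 ≤ V x)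
    (hVfin : ∀ M : ℝ, {x | V x ≤ M}.Finite) {C : ℝ} (hVC : ∀ x, jumpGenerator r T V x ≤ C) :
    (∀ t : ℝ, 0 ≤ t → IsMarkovKernel (markovSemigroup (jumpGenerator r T) t)) ∧
      IsAttractive (markovSemigroup (jumpGenerator r T)) := by
  have hM : ∀ t : ℝ, 0 ≤ t → IsMarkovKernel (markovSemigroup (jumpGenerator r T) t) :=
    fun t ht => ⟨fun η => ⟨by
      rw [markovSemigroup_apply_univ, tsum_transitionProb_eq_one hr hV0 hVfin hVC ht]⟩⟩
  refine ⟨hM, fun μ ν hμ hν hle t ht => ?_⟩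
  have := hM t ht
  refine stochasticallyLE_of_bounded fun F hFmono hF0 hF => ?_
  rw [integral_bind_markovSemigroup hr hF0 hF ht, integral_bind_markovSemigroup hr hF0 hF ht]
  have hint : ∀ (ρ : Measure Ω) [IsProbabilityMeasure ρ],
      Integrable (fun η => (semigroupApply (jumpGenerator r T) F t η).toReal) ρ := fun ρ _ =>
    Integrable.of_bound (Measurable.of_discrete).aestronglyMeasurable 1
      (Filter.Eventually.of_forall fun η => by
        rw [Real.norm_of_nonneg ENNReal.toReal_nonneg]
        exact toReal_semigroupApply_le_one hr hF ht η)
  exact hle _ (monotone_toReal_semigroupApply hr hrmono hT hTr hV0 hVfin hVC hFmono hF0 hF ht)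
    (hint μ) (hint ν)

end Kernel

/-! ### The zero-range process as a jump process -/

section ZeroRange

variable {N : ℕ}

/-- The rates of the zero-range process: `Sum.inl (x, y)` is the jump of a particle from `x` to
`y`, `Sum.inr (b, c)` is the creation (`c = true`) or removal (`c = false`) of a particle at the
left (`b = true`) or right (`b = false`) end. -/
def zeroRangeRate (hN : 2 ≤ N) (g : ℕ → ℝ) (κ θ α lam β δ : ℝ) :
    (Bulk N × Bulk N) ⊕ (Bool × Bool) → Config N → ℝ
  | Sum.inl (x, y), η => if |((x : ℕ) : ℤ) - ((y : ℕ) : ℤ)| = 1 then g (η x) else 0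
  | Sum.inr (true, true), _ => κ * (α / (N : ℝ) ^ θ)
  | Sum.inr (true, false), η => κ * (lam * g (η (leftSite hN)) / (N : ℝ) ^ θ)
  | Sum.inr (false, true), _ => κ * (β / (N : ℝ) ^ θ)
  | Sum.inr (false, false), η => κ * (δ * g (η (rightSite hN)) / (N : ℝ) ^ θ)

/-- The jumps of the zero-range process. -/
def zeroRangeJump (hN : 2 ≤ N) : (Bulk N × Bulk N) ⊕ (Bool × Bool) → Config N → Config N
  | Sum.inl (x, y), η => moveParticle η x y
  | Sum.inr (true, true), η => addParticle η (leftSite hN)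
  | Sum.inr (true, false), η => removeParticle η (leftSite hN)
  | Sum.inr (false, true), η => addParticle η (rightSite hN)
  | Sum.inr (false, false), η => removeParticle η (rightSite hN)

theorem zeroRangeGenerator_eq_jumpGenerator (hN : 2 ≤ N) (g : ℕ → ℝ) (κ θ α lam β δ : ℝ) :
    zeroRangeGenerator hN g κ θ α lam β δ =
      jumpGenerator (zeroRangeRate hN g κ θ α lam β δ) (zeroRangeJump hN) := by
  funext f η
  simp only [zeroRangeGenerator, jumpGenerator, bulkGenerator, leftGenerator, rightGenerator,
    Fintype.sum_sum_type, Fintype.sum_prod_type, Fintype.sum_bool, zeroRangeRate, zeroRangeJump,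
    ite_mul, zero_mul]
  ring

/-- Truncated subtraction is monotone, so this holds even at an empty `x`, where the map is not a
genuine particle move. -/
theorem monotone_moveParticle (x y : Bulk N) :
    Monotone fun η : Config N => moveParticle η x y := by
  intro η ξ h z
  have hz : η z ≤ ξ z := h z
  change moveParticle η x y z ≤ moveParticle ξ x y z
  simp only [moveParticle]
  split_ifs <;> omega

theorem monotone_addParticle (x : Bulk N) : Monotone fun η : Config N => addParticle η x := by
  intro η ξ h z
  have hz : η z ≤ ξ z := h z
  have hx : η x ≤ ξ x := h x
  change addParticle η x z ≤ addParticle ξ x z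
  simp only [addParticle, Function.update_apply]
  split_ifs <;> omega

theorem monotone_removeParticle (x : Bulk N) :
    Monotone fun η : Config N => removeParticle η x := by
  intro η ξ h z
  have hz : η z ≤ ξ z := h z
  have hx : η x ≤ ξ x := h x
  change removeParticle η x z ≤ removeParticle ξ x z
  simp only [removeParticle, Function.update_apply]
  split_ifs <;> omega

theorem le_moveParticle_of_lt {η ξ : Config N} (h : η ≤ ξ) {x : Bulk N} (hx : η x < ξ x)
    (y : Bulk N) : η ≤ moveParticle ξ x y := by
  intro z
  have hz : η z ≤ ξ z := h z
  change η z ≤ moveParticle ξ x y z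
  simp only [moveParticle]
  split_ifs with h1 h2
  · subst h1
    omega
  · omega
  · exact hz

theorem le_removeParticle_of_lt {η ξ : Config N} (h : η ≤ ξ) {x : Bulk N} (hx : η x < ξ x) :
    η ≤ removeParticle ξ x := by
  intro z
  have hz : η z ≤ ξ z := h z
  change η z ≤ removeParticle ξ x z
  simp only [removeParticle, Function.update_apply]
  split_ifs with h1
  · subst h1
    omega
  · exact hz

/-- The number of particles. -/
def particleNumber (η : Config N) : ℝ := ∑ x, (η x : ℝ)

theorem particleNumber_update (η : Config N) (x : Bulk N) (k : ℕ) :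
    particleNumber (Function.update η x k) = particleNumber η + (k - η x) := by
  rw [particleNumber, particleNumber, ← Finset.add_sum_erase _ _ (Finset.mem_univ x),
    ← Finset.add_sum_erase (a := x) Finset.univ (fun z => (η z : ℝ)) (Finset.mem_univ x),
    Function.update_self]
  have : ∑ z ∈ Finset.univ.erase x, ((Function.update η x k z : ℕ) : ℝ) =
      ∑ z ∈ Finset.univ.erase x, (η z : ℝ) :=
    Finset.sum_congr rfl fun z hz => by rw [Function.update_of_ne (Finset.ne_of_mem_erase hz)]
  rw [this]
  ring

theorem particleNumber_addParticle (η : Config N) (x : Bulk N) :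
    particleNumber (addParticle η x) = particleNumber η + 1 := by
  rw [addParticle, particleNumber_update]
  push_cast
  ring

theorem particleNumber_removeParticle_le (η : Config N) (x : Bulk N) :
    particleNumber (removeParticle η x) ≤ particleNumber η := by
  rw [removeParticle, particleNumber_update]
  have : ((η x - 1 : ℕ) : ℝ) ≤ η x := Nat.cast_le.2 (Nat.sub_le _ _)
  linarith

theorem particleNumber_moveParticle {η : Config N} {x y : Bulk N} (hxy : x ≠ y)
    (hx : 0 < η x) : particleNumber (moveParticle η x y) = particleNumber η := by
  -- A move is a creation at `y` followed by a removal at `x`; `hx` ensures that the truncated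
  -- subtraction really removes a particle.
  have h : moveParticle η x y = Function.update (addParticle η y) x (η x - 1) := by
    funext z
    simp only [moveParticle, addParticle, Function.update_apply]
    split_ifs with h1 h2
    · rw [h1]
    · rw [h2]
    · rfl
  rw [h, particleNumber_update, particleNumber_addParticle, addParticle,
    Function.update_of_ne hxy, Nat.cast_sub hx]
  push_cast
  ring

theorem finite_particleNumber_le (M : ℝ) : {η : Config N | particleNumber η ≤ M}.Finite := by
  refine (Set.Finite.pi' fun _ : Bulk N => Set.finite_Iic ⌊M⌋₊).subset fun η hη x => ?_
  refine Nat.le_floor (le_trans ?_ hη)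
  exact Finset.single_le_sum (f := fun z => (η z : ℝ)) (fun _ _ => Nat.cast_nonneg _)
    (Finset.mem_univ x)

end ZeroRange
end

theorem mainTheorem5 (N : ℕ) (hN : 2 ≤ N) (g : ℕ → ℝ) (hg0 : g 0 = 0)
    (hgpos : ∀ k : ℕ, 1 ≤ k → 0 < g k)
    (hgvar : ∃ C : ℝ, ∀ k : ℕ, 1 ≤ k → |g (k + 1) - g k| ≤ C)
    (κ θ α lam β δ : ℝ) (hκ : 0 < κ) (hθ : 0 ≤ θ)
    (hα : 0 ≤ α) (hlam : 0 ≤ lam) (hβ : 0 ≤ β) (hδ : 0 ≤ δ)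
    (hgmono : Monotone g) :
    (∀ t : ℝ, 0 ≤ t →
      IsMarkovKernel (markovSemigroup (zeroRangeGenerator hN g κ θ α lam β δ) t)) ∧
    IsAttractive (markovSemigroup (zeroRangeGenerator hN g κ θ α lam β δ)) := by
  rw [zeroRangeGenerator_eq_jumpGenerator]
  have hg : ∀ k, 0 ≤ g k := fun k => hg0 ▸ hgmono (Nat.zero_le k)
  have hNθ : 0 ≤ (N : ℝ) ^ θ := by positivity
  have hcreate : ∀ {a : ℝ}, 0 ≤ a → 0 ≤ κ * (a / (N : ℝ) ^ θ) := fun ha =>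
    mul_nonneg hκ.le (div_nonneg ha hNθ)
  have hremove : ∀ {a : ℝ}, 0 ≤ a → ∀ k, 0 ≤ κ * (a * g k / (N : ℝ) ^ θ) := fun ha k =>
    hcreate (mul_nonneg ha (hg k))
  have hremove_mono : ∀ {a : ℝ}, 0 ≤ a →
      Monotone fun k => κ * (a * g k / (N : ℝ) ^ θ) := fun ha j k hjk => by
    have := hgmono hjk
    dsimp only
    gcongr
  refine isMarkovKernel_and_isAttractive_of_jumpGenerator (V := particleNumber)
    (C := κ * (α / (N : ℝ) ^ θ) + κ * (β / (N : ℝ) ^ θ)) ?_ ?_ ?_ ?_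
    (fun η => Finset.sum_nonneg fun _ _ => Nat.cast_nonneg _) finite_particleNumber_le ?_
  · rintro (⟨x, y⟩ | ⟨_ | _, _ | _⟩) η <;> simp only [zeroRangeRate]
    · split_ifs
      exacts [hg _, le_rfl]
    exacts [hremove hδ _, hcreate hβ, hremove hlam _, hcreate hα]
  · rintro (⟨x, y⟩ | ⟨_ | _, _ | _⟩) η ξ h <;> simp only [zeroRangeRate]
    · split_ifs
      exacts [hgmono (h x), le_rfl]
    exacts [hremove_mono hδ (h _), le_rfl, hremove_mono hlam (h _), le_rfl]
  · rintro (⟨x, y⟩ | ⟨_ | _, _ | _⟩)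
    exacts [monotone_moveParticle x y, monotone_removeParticle _, monotone_addParticle _,
      monotone_removeParticle _, monotone_addParticle _]
  -- Creation rates are constant, so only moves and removals can have a strictly larger rate in `ξ`;
  -- monotonicity of `g` then forces strictly more particles at the site concerned.
  · rintro (⟨x, y⟩ | ⟨_ | _, _ | _⟩) η ξ h hlt <;> simp only [zeroRangeRate] at hlt
    · split_ifs at hlt
      · exact le_moveParticle_of_lt h (hgmono.reflect_lt hlt) y
      · exact absurd hlt (lt_irrefl _)
    · exact le_removeParticle_of_lt h ((hremove_mono hδ).reflect_lt hlt)
    · exact absurd hlt (lt_irrefl _)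
    · exact le_removeParticle_of_lt h ((hremove_mono hlam).reflect_lt hlt)
    · exact absurd hlt (lt_irrefl _)
  · intro η
    simp only [jumpGenerator, Fintype.sum_sum_type, Fintype.sum_prod_type, Fintype.sum_bool,
      zeroRangeRate, zeroRangeJump, particleNumber_addParticle, add_sub_cancel_left, mul_one]
    have hbulk : ∑ x : Bulk N, ∑ y : Bulk N,
        (if |((x : ℕ) : ℤ) - ((y : ℕ) : ℤ)| = 1 then g (η x) else 0) *
          (particleNumber (moveParticle η x y) - particleNumber η) = 0 := by
      refine Finset.sum_eq_zero fun x _ => Finset.sum_eq_zero fun y _ => ?_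
      split_ifs with hxy
      -- On an empty site the truncated move would create a particle, but its rate is `g 0 = 0`.
      · rcases Nat.eq_zero_or_pos (η x) with h | h
        · simp [h, hg0]
        · rw [particleNumber_moveParticle _ h, sub_self, mul_zero]
          rintro rfl
          simp at hxy
      · exact zero_mul _
    rw [hbulk]
    have h1 := mul_nonpos_of_nonneg_of_nonpos (hremove hlam (η (leftSite hN)))
      (sub_nonpos.2 (particleNumber_removeParticle_le η (leftSite hN)))
    have h2 := mul_nonpos_of_nonneg_of_nonpos (hremove hδ (η (rightSite hN)))
      (sub_nonpos.2 (particleNumber_removeParticle_le η (rightSite hN)))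
    linarith
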